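/- **Setting.** The square lattice $\mathbb{Z}^2$ is embedded in the plane with edges parallel to the axes and with its faces centred at the points $(i,j)$ with integer coordinates; a face is *even* or *odd* according to the parity of $i+j$, and $F^\bullet$ is the set of even faces. A *domain* $\mathcal{D}$ is the part of the lattice surrounded by a simple cyclic lattice path, including that path. A spin configuration $\sigma:\{\text{faces}\}\to\{-1,1\}$ satisfies the *ice rule* if around each vertex some pair of diagonally adjacent faces has equal spins. A vertex is of type $A$ if of its two diagonal pairs of faces only the pair (lower left, upper right) has equal spins, of type $B$ if only the pair (upper left, lower right) has equal spins, and of type $C$ if both pairs have equal spins; $n_A(\sigma),n_B(\sigma),n_C(\sigma)$ denote the numbers of vertices of $\mathcal{D}$ (including those on its boundary path) of each type. For $a,b,c>0$ and a configuration $\tau$ satisfying the ice rule, $\mathsf{Spin}^{\tau}_{\mathcal{D},a,b,c}$ is the probability measure supported on the (finitely many) configurations $\sigma$ that satisfy the ice rule and coincide with $\tau$ at all faces outside of $\mathcal{D}$, with probabilities proportional to $a^{n_A(\sigma)}b^{n_B(\sigma)}c^{n_C(\sigma)}$. Write $\sigma^\bullet$ for the restriction of $\sigma$ to $F^\bullet$,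 and order $\{-1,1\}^{F^\bullet}$ pointwise, with join $\vee$ and meet $\wedge$. **Theorem (Positive association: spin representation).** Let $\mathcal{D}$ be a domain, let $\tau$ satisfy the ice rule and be equal to $1$ at all odd faces outside of $\mathcal{D}$, and let $a,b,c>0$ satisfy $a\le c$ and $b\le c$. Then the marginal $\mu(\eta)=\mathsf{Spin}^{\tau}_{\mathcal{D},a,b,c}(\sigma^\bullet=\eta)$ satisfies the FKG lattice condition: for all $\eta,\eta'\in\{-1,1\}^{F^\bullet}$, $$\mu(\eta\vee\eta')\,\mu(\eta\wedge\eta')\ \ge\ \mu(\eta)\,\mu(\eta').$$ In particular, for all increasing functions $f,g:\{-1,1\}^{F^\bullet}\to\mathbb{R}$, $$\mathsf{Spin}^{\tau}_{\mathcal{D},a,b,c}\big(f(\sigma^\bullet)g(\sigma^\bullet)\big)\ \ge\ \mathsf{Spin}^{\tau}_{\mathcal{D},a,b,c}\big(f(\sigma^\bullet)\big)\cdot\mathsf{Spin}^{\tau}_{\mathcal{D},a,b,c}\big(g(\sigma^\bullet)\big).$$ -/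

import Mathlib

/-- The **FKG lattice condition** for a (discrete) probability mass function on a lattice. -/
def FKGLatticeCondition {L : Type*} [Lattice L] (μ : L → ℝ) : Prop :=
  ∀ x y : L, μ x * μ y ≤ μ (x ⊔ y) * μ (x ⊓ y)

namespace SixVertex

/-- Faces of the square lattice, identified with their centres `(i, j)`. -/
abbrev Face : Type := ℤ × ℤ

/-- Vertices of the square lattice. The pair `(i, j)` stands for the point
`(i + 1/2, j + 1/2)`, that is, the upper right corner of the face centred at `(i, j)`. -/
abbrev Vertex : Type := ℤ × ℤ

/-- The square lattice: vertices are adjacent iff they are at Euclidean distance `1`. -/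
def lattice : SimpleGraph Vertex where
  Adj z w := |z.1 - w.1| + |z.2 - w.2| = 1
  symm := ⟨fun z w h => by rwa [abs_sub_comm w.1, abs_sub_comm w.2]⟩
  loopless := ⟨fun z h => by simp at h⟩

/-- The four faces around a vertex. -/
def sw (z : Vertex) : Face := z
/-- The lower right face at a vertex. -/
def se (z : Vertex) : Face := (z.1 + 1, z.2)
/-- The upper left face at a vertex. -/
def nw (z : Vertex) : Face := (z.1, z.2 + 1)
/-- The upper right face at a vertex. -/
def ne (z : Vertex) : Face := (z.1 + 1, z.2 + 1)

/-- The vertex `z` is one of the four corners of the face `u`. -/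
def Borders (z : Vertex) (u : Face) : Prop :=
  u = sw z ∨ u = se z ∨ u = nw z ∨ u = ne z

/-- The faces of the square lattice, two distinct faces being adjacent iff they are the two sides
of an edge which does not belong to the set `S` of edges. -/
def facesOff (S : Set (Sym2 Vertex)) : SimpleGraph Face where
  Adj u v := u ≠ v ∧ ∃ z w : Vertex, lattice.Adj z w ∧ s(z, w) ∉ S ∧
    Borders z u ∧ Borders w u ∧ Borders z v ∧ Borders w v
  symm := ⟨fun _ _ ⟨h, z, w, h1, h2, h3, h4, h5, h6⟩ =>
    ⟨h.symm, z, w, h1, h2, h5, h6, h3, h4⟩⟩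
  loopless := ⟨fun _ h => h.1 rfl⟩

/-- A **domain** of the square lattice is the part of the lattice that is surrounded by a simple
cyclic path (the boundary of the domain), together with this path. -/
structure Domain where
  /-- the starting point of the boundary path -/
  base : Vertex
  /-- the boundary path -/
  boundary : lattice.Walk base base
  /-- the boundary is a simple cycle -/
  isCycle : boundary.IsCycle

namespace Domain

/-- The faces of a domain are the faces surrounded by its boundary: those from which only
finitely many faces can be reached without crossing an edge of the boundary. -/
def faces (D : Domain) : Set Face :=
  {u | {v | (facesOff {e | e ∈ D.boundary.edges}).Reachable u v}.Finite}

/-- The vertices of a domain are those on its boundary and those surrounded by it. -/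
def vertices (D : Domain) : Set Vertex :=
  {z | z ∈ D.boundary.support ∨ ∃ u ∈ D.faces, Borders z u}

/-- A bound for the coordinates of the vertices of the boundary. -/
lemma exists_bound (D : Domain) :
    ∃ N : ℤ, ∀ z ∈ D.boundary.support, |z.1| ≤ N ∧ |z.2| ≤ N := by
  refine ⟨(D.boundary.support.map fun z => |z.1| + |z.2|).sum, fun z hz => ?_⟩
  have h : |z.1| + |z.2| ≤ (D.boundary.support.map fun z => |z.1| + |z.2|).sum := by
    apply List.single_le_sum
    · intro x hx
      obtain ⟨w, -, rfl⟩ := List.mem_map.1 hx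
      positivity
    · exact List.mem_map.2 ⟨z, hz, rfl⟩
  have h1 := abs_nonneg z.1
  have h2 := abs_nonneg z.2
  constructor <;> linarith

lemma notMem_faces_of_ray (D : Domain) (g : ℕ → Face) (hg : Function.Injective g)
    (h : ∀ k, (facesOff {e | e ∈ D.boundary.edges}).Adj (g k) (g (k + 1))) :
    g 0 ∉ D.faces := by
  intro h0
  have hr : ∀ k, (facesOff {e | e ∈ D.boundary.edges}).Reachable (g 0) (g k) := by
    intro k
    induction k with
    | zero => exact SimpleGraph.Reachable.refl _
    | succ k ih => exact ih.trans (h k).reachable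
  exact Set.infinite_of_injective_forall_mem hg hr h0

lemma finite_faces (D : Domain) : D.faces.Finite := by
  obtain ⟨N, hN⟩ := D.exists_bound
  have key : ∀ z w : Vertex, (N < |z.1| ∨ N < |z.2|) →
      s(z, w) ∉ {e | e ∈ D.boundary.edges} := by
    intro z w hz hmem
    have := hN z (D.boundary.fst_mem_support_of_mem_edges hmem)
    omega
  apply (Set.finite_Icc ((-N - 1, -N - 1) : ℤ × ℤ) (N + 1, N + 1)).subset
  rintro ⟨i, j⟩ hu
  by_contra hcon
  have hcases : N + 1 < i ∨ i < -N - 1 ∨ N + 1 < j ∨ j < -N - 1 := by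
    by_contra h
    push Not at h
    exact hcon ⟨⟨by simp; omega, by simp; omega⟩, ⟨by simp; omega, by simp; omega⟩⟩
  rcases hcases with h | h | h | h
  · refine D.notMem_faces_of_ray (fun k : ℕ => (i + k, j)) ?_ ?_ (by simpa using hu)
    · intro k l hkl; simpa using hkl
    · intro k
      refine ⟨by simp, (i + k, j - 1), (i + k, j), by simp [lattice], key _ _ (Or.inl ?_), ?_⟩
      · rw [lt_abs]; left; simp only; omega
      · simp [Borders, sw, se, nw, ne, Prod.ext_iff]; omega
  · refine D.notMem_faces_of_ray (fun k : ℕ => (i - k, j)) ?_ ?_ (by simpa using hu)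
    · intro k l hkl; simpa using hkl
    · intro k
      refine ⟨by simp, (i - k - 1, j - 1), (i - k - 1, j), by simp [lattice],
        key _ _ (Or.inl ?_), ?_⟩
      · rw [lt_abs]; right; simp only; omega
      · simp [Borders, sw, se, nw, ne, Prod.ext_iff]; omega
  · refine D.notMem_faces_of_ray (fun k : ℕ => (i, j + k)) ?_ ?_ (by simpa using hu)
    · intro k l hkl; simpa using hkl
    · intro k
      refine ⟨by simp, (i - 1, j + k), (i, j + k), by simp [lattice], key _ _ (Or.inr ?_), ?_⟩
      · rw [lt_abs]; left; simp only; omega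
      · simp [Borders, sw, se, nw, ne, Prod.ext_iff]; omega
  · refine D.notMem_faces_of_ray (fun k : ℕ => (i, j - k)) ?_ ?_ (by simpa using hu)
    · intro k l hkl; simpa using hkl
    · intro k
      refine ⟨by simp, (i - 1, j - k - 1), (i, j - k - 1), by simp [lattice],
        key _ _ (Or.inr ?_), ?_⟩
      · rw [lt_abs]; right; simp only; omega
      · simp [Borders, sw, se, nw, ne, Prod.ext_iff]; omega

lemma finite_vertices (D : Domain) : D.vertices.Finite := by
  have h1 : {z | z ∈ D.boundary.support}.Finite := D.boundary.support.finite_toSet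
  have h2 : (⋃ u ∈ D.faces, {z | Borders z u}).Finite := by
    refine D.finite_faces.biUnion fun u _ => ?_
    apply (Set.finite_Icc ((u.1 - 1, u.2 - 1) : ℤ × ℤ) (u.1, u.2)).subset
    rintro ⟨x, y⟩ hz
    simp only [Borders, sw, se, nw, ne, Set.mem_ofPred_eq, Prod.ext_iff] at hz
    exact ⟨⟨by simp only; omega, by simp only; omega⟩, ⟨by simp only; omega, by simp only; omega⟩⟩
  apply (h1.union h2).subset
  rintro z (hz | ⟨u, hu, hz⟩)
  · exact Or.inl hz
  · exact Or.inr (Set.mem_biUnion hu hz)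

end Domain

/-- Spin configurations; `ℤˣ = {-1, 1}` with its order `-1 < 1`. -/
abbrev SpinConfig : Type := Face → ℤˣ

/-- The ice rule: around each vertex, some pair of diagonally adjacent faces has equal spins. -/
def IceRule (σ : SpinConfig) : Prop :=
  ∀ z : Vertex, σ (sw z) = σ (ne z) ∨ σ (nw z) = σ (se z)

/-- Vertices of types 1 and 2 (weight `a`): only the lower left and upper right spins agree. -/
def IsTypeA (σ : SpinConfig) (z : Vertex) : Prop :=
  σ (sw z) = σ (ne z) ∧ σ (nw z) ≠ σ (se z)

/-- Vertices of types 3 and 4 (weight `b`): only the upper left and lower right spins agree. -/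
def IsTypeB (σ : SpinConfig) (z : Vertex) : Prop :=
  σ (sw z) ≠ σ (ne z) ∧ σ (nw z) = σ (se z)

/-- Vertices of types 5 and 6 (weight `c`): both pairs of diagonally adjacent spins agree. -/
def IsTypeC (σ : SpinConfig) (z : Vertex) : Prop :=
  σ (sw z) = σ (ne z) ∧ σ (nw z) = σ (se z)

/-- The unnormalised weight `a ^ (n₁ + n₂) * b ^ (n₃ + n₄) * c ^ (n₅ + n₆)` of a configuration,
where `nᵢ` is the number of vertices of `D` of type `i`. -/
noncomputable def weight (D : Domain) (a b c : ℝ) (σ : SpinConfig) : ℝ :=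
  a ^ {z ∈ D.vertices | IsTypeA σ z}.ncard *
  b ^ {z ∈ D.vertices | IsTypeB σ z}.ncard *
  c ^ {z ∈ D.vertices | IsTypeC σ z}.ncard

/-- The configurations in the support of the finite-volume measure: those that satisfy the ice
rule and coincide with `τ` at all faces outside of `D`. -/
def admissible (D : Domain) (τ : SpinConfig) : Set SpinConfig :=
  {σ | IceRule σ ∧ ∀ u, u ∉ D.faces → σ u = τ u}

lemma finite_admissible (D : Domain) (τ : SpinConfig) : (admissible D τ).Finite := by
  have : Finite D.faces := D.finite_faces
  apply Set.Finite.of_finite_image (f := fun σ (u : D.faces) => σ u) (Set.toFinite _)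
  intro σ hσ σ' hσ' h
  funext u
  by_cases hu : u ∈ D.faces
  · exact congrFun h ⟨u, hu⟩
  · rw [hσ.2 u hu, hσ'.2 u hu]

/-- The normalising constant (partition function). -/
noncomputable def partitionFunction (D : Domain) (a b c : ℝ) (τ : SpinConfig) : ℝ :=
  ∑ σ ∈ (finite_admissible D τ).toFinset, weight D a b c σ

/-- The expectation of a function of the spins under the finite-volume spin measure on `D` with
parameters `a, b, c` and boundary condition `τ`; this measure gives to each admissible
configuration a probability proportional to its weight. -/
noncomputable def spinExpect (D : Domain) (a b c : ℝ) (τ : SpinConfig) (F : SpinConfig → ℝ) : ℝ :=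
  ∑ σ ∈ (finite_admissible D τ).toFinset,
    weight D a b c σ / partitionFunction D a b c τ * F σ

/-- The expectation is that of a probability measure: the normalising constant is positive. -/
lemma partitionFunction_pos (D : Domain) {a b c : ℝ} (ha : 0 < a) (hb : 0 < b) (hc : 0 < c)
    {τ : SpinConfig} (hτ : IceRule τ) : 0 < partitionFunction D a b c τ := by
  refine Finset.sum_pos (fun σ _ => by unfold weight; positivity) ⟨τ, ?_⟩
  rw [Set.Finite.mem_toFinset]
  exact ⟨hτ, fun _ _ => rfl⟩

/-- Even faces: those whose centre `(i, j)` has `i + j` even. -/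
def EvenFace : Type := {u : Face // Even (u.1 + u.2)}

/-- The restriction of a spin configuration to the even faces. -/
def evenPart (σ : SpinConfig) : EvenFace → ℤˣ := fun u => σ u.1

open scoped Classical in
/-- The marginal on the even spins: the probability that the configuration restricted to the even
faces equals `η`. -/
noncomputable def evenMarginal (D : Domain) (a b c : ℝ) (τ : SpinConfig) (η : EvenFace → ℤˣ) : ℝ :=
  spinExpect D a b c τ fun σ => if evenPart σ = η then 1 else 0

end SixVertex

/-! Fix the even spins. The odd spins then form an Ising model whose edges are the vertices of the
domain, each joining its two odd faces. By the ice rule a disagreement is forbidden where the even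
spins differ; where they agree it costs `a / c` or `b / c`, according to the parity of the vertex
(`localWeight_glue`). Both ratios are at most one, so the model is ferromagnetic. Hence the marginal
of a compatible even configuration is a product of local weights times an Ising partition function
(`evenMarginal_of_compatible`).

The edge set of this model is not monotone in the even spins. It is, however, the disjoint union of
the edges between two positive even faces, which increases, and those between two negative ones,
which decreases. The partition function factorises over these two sets (`isingZ_evenAgree`). This is
where planarity enters: an odd spin is the height modulo 4, and reading the height modulo 8 gives an
odd configuration that keeps exactly the disagreements at positive even faces
(`exists_odd_restriction`). Its boundary values are right because the exterior is connected and its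
odd faces have spin 1, which pins their height to a single value.

Each factor is log-supermodular in its edge set by the second Griffiths inequality
(`ising_griffiths`, `isingZ_indicator_mul_le`), since forbidding a disagreement multiplies the
weight by a positive combination of characters. The local weights are compared vertex by vertex
(`evenWeight_mul_le`). The inequality for increasing functions is then the FKG inequality on the
finite lattice of even spins inside the domain. -/

/-! ### Characters of order two and Griffiths inequalities. -/

/-- The cone generated by the real-valued characters of order two of a group. -/
inductive CharCone {G : Type*} [Group G] : (G → ℝ) → Prop
  | char (r : ℝ) (hr : 0 ≤ r) (χ : G →* ℤˣ) : CharCone fun g => r * ((χ g : ℤ) : ℝ)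
  | add {f h : G → ℝ} : CharCone f → CharCone h → CharCone fun g => f g + h g

namespace CharCone

variable {G : Type*}

lemma const [Group G] {r : ℝ} (hr : 0 ≤ r) : CharCone fun _ : G => r := by
  simpa using CharCone.char (G := G) r hr 1

lemma mul [Group G] {f h : G → ℝ} (hf : CharCone f) (hh : CharCone h) :
    CharCone fun g => f g * h g := by
  induction hf with
  | char r hr χ =>
    induction hh with
    | char r' hr' χ' =>
      convert CharCone.char (r * r') (mul_nonneg hr hr') (χ * χ') using 2 with g
      simp only [MonoidHom.mul_apply, Units.val_mul, Int.cast_mul]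
      ring
    | add _ _ ih₁ ih₂ => simpa only [mul_add] using ih₁.add ih₂
  | add _ _ ih₁ ih₂ => simpa only [add_mul] using ih₁.add ih₂

lemma prod [Group G] {ι : Type*} {s : Finset ι} {f : ι → G → ℝ}
    (hf : ∀ i ∈ s, CharCone (f i)) : CharCone fun g => ∏ i ∈ s, f i g := by
  classical
  induction s using Finset.induction_on with
  | empty => simpa using const zero_le_one
  | insert i s hi ih =>
    simp only [Finset.prod_insert hi]
    exact (hf i (by simp)).mul (ih fun j hj => hf j (by simp [hj]))

/-- A character sums to the order of the group if it is trivial and to zero otherwise. -/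
lemma sum_nonneg [Group G] [Fintype G] {f : G → ℝ} (hf : CharCone f) : 0 ≤ ∑ g, f g := by
  classical
  induction hf with
  | char r hr χ =>
    have h := sum_hom_units ((Int.castRingHom ℝ : ℤ →* ℝ).comp ((Units.coeHom ℤ).comp χ))
    simp only [MonoidHom.comp_apply, Units.coeHom_apply, MonoidHom.coe_coe,
      Int.coe_castRingHom] at h
    rw [← Finset.mul_sum, h]
    split_ifs <;> positivity
  | add _ _ ih₁ ih₂ =>
    rw [Finset.sum_add_distrib]
    exact add_nonneg ih₁ ih₂

/-- The function equals `(1 + t) / 2 + (1 - t) / 2 * χ`; the bound `t ≤ 1` is ferromagnetism. -/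
lemma ite_char [Group G] (χ : G →* ℤˣ) {t : ℝ} (h0 : 0 ≤ t) (h1 : t ≤ 1) :
    CharCone fun g => if χ g = 1 then 1 else t := by
  convert (const (G := G) (r := (1 + t) / 2) (by linarith)).add
    (CharCone.char ((1 - t) / 2) (by linarith) χ) using 2 with g
  rcases Int.units_eq_one_or (χ g) with h | h
  · simp [h]; ring
  · simp [h]; ring

end CharCone

/-- The weight of a group element in the Ising model with disagreement weights `t` on the edges
`s`, the edge variables being the characters `x`. -/
noncomputable def isingWeight {G ι : Type*} [Group G] (s : Finset ι) (x : ι → G →* ℤˣ)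
    (t : ι → ℝ) (g : G) : ℝ :=
  ∏ i ∈ s, if x i g = 1 then 1 else t i

/-- The partition function of the Ising model. -/
noncomputable def isingZ {G ι : Type*} [Group G] [Fintype G] (s : Finset ι) (x : ι → G →* ℤˣ)
    (t : ι → ℝ) : ℝ :=
  ∑ g, isingWeight s x t g

section Ising

variable {G ι : Type*} (s : Finset ι)

lemma isingWeight_mul [Group G] (x : ι → G →* ℤˣ) (t u : ι → ℝ) (g : G) :
    isingWeight s x (t * u) g = isingWeight s x t g * isingWeight s x u g := by
  unfold isingWeight
  rw [← Finset.prod_mul_distrib]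
  refine Finset.prod_congr rfl fun i _ => ?_
  split_ifs <;> simp

lemma isingWeight_nonneg [Group G] (x : ι → G →* ℤˣ) {t : ι → ℝ} (h0 : ∀ i, 0 ≤ t i) (g : G) :
    0 ≤ isingWeight s x t g :=
  Finset.prod_nonneg fun i _ => by split_ifs <;> simp [h0 i]

lemma isingZ_nonneg [Group G] [Fintype G] (x : ι → G →* ℤˣ) {t : ι → ℝ} (h0 : ∀ i, 0 ≤ t i) :
    0 ≤ isingZ s x t :=
  Finset.sum_nonneg fun g _ => isingWeight_nonneg s x h0 g

lemma isingZ_mono [Group G] [Fintype G] (x : ι → G →* ℤˣ) {t u : ι → ℝ} (h0 : ∀ i, 0 ≤ t i)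
    (htu : ∀ i, t i ≤ u i) : isingZ s x t ≤ isingZ s x u := by
  refine Finset.sum_le_sum fun g _ => Finset.prod_le_prod (fun i _ => ?_) fun i _ => ?_
  · split_ifs <;> simp [h0 i]
  · split_ifs <;> simp [htu i]

lemma charCone_isingWeight [Group G] (x : ι → G →* ℤˣ) {t : ι → ℝ} (h0 : ∀ i, 0 ≤ t i)
    (h1 : ∀ i, t i ≤ 1) : CharCone (isingWeight s x t) :=
  CharCone.prod fun i _ => CharCone.ite_char (x i) (h0 i) (h1 i)

/-- The product is taken edge by edge: if `x i k = 1`, the two factors coincide and give a square in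
the cone; if `x i k = -1`, exactly one of them is a disagreement and their product is the constant
`t i`. -/
lemma charCone_isingWeight_mul_shift [Group G] (x : ι → G →* ℤˣ) {t : ι → ℝ}
    (h0 : ∀ i, 0 ≤ t i) (h1 : ∀ i, t i ≤ 1) (k : G) :
    CharCone fun g => isingWeight s x t g * isingWeight s x t (g * k) := by
  unfold isingWeight
  simp only [← Finset.prod_mul_distrib]
  refine CharCone.prod fun i _ => ?_
  rcases Int.units_eq_one_or (x i k) with h | h
  · simpa [h] using (CharCone.ite_char (x i) (h0 i) (h1 i)).mul
      (CharCone.ite_char (x i) (h0 i) (h1 i))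
  · convert CharCone.const (G := G) (h0 i) using 2 with g
    rcases Int.units_eq_one_or (x i g) with h' | h' <;> simp [h, h']

/-- The **second Griffiths inequality** for the Ising model. -/
theorem ising_griffiths [CommGroup G] [Fintype G] (x : ι → G →* ℤˣ) {t : ι → ℝ}
    (h0 : ∀ i, 0 ≤ t i) (h1 : ∀ i, t i ≤ 1) {f h : G → ℝ} (hf : CharCone f) (hh : CharCone h) :
    (∑ g, isingWeight s x t g * f g) * (∑ g, isingWeight s x t g * h g) ≤
      isingZ s x t * ∑ g, isingWeight s x t g * (f g * h g) := by
  induction hh with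
  | char r hr χ =>
    set w := isingWeight s x t
    have hshift : ∀ (F : G → ℝ) (g : G), ∑ k, F (g * k) = ∑ k, F k := fun F g =>
      Fintype.sum_equiv (Equiv.mulLeft g) _ _ fun _ => rfl
    -- Two independent copies are written as `g` and `g * k`. The covariance becomes a sum over `k`
    -- in which the only signed factor independent of `g` is `1 - χ k ≥ 0`.
    have key : isingZ s x t * (∑ g, w g * (f g * (r * ((χ g : ℤ) : ℝ)))) -
        (∑ g, w g * f g) * (∑ g, w g * (r * ((χ g : ℤ) : ℝ))) =
        ∑ k, r * (1 - ((χ k : ℤ) : ℝ)) *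
          ∑ g, (w g * w (g * k)) * (f g * (1 * ((χ g : ℤ) : ℝ))) := by
      have e1 : isingZ s x t * (∑ g, w g * (f g * (r * ((χ g : ℤ) : ℝ)))) =
          ∑ g, ∑ k, (w g * (f g * (r * ((χ g : ℤ) : ℝ)))) * w (g * k) := by
        rw [mul_comm, Finset.sum_mul]
        refine Finset.sum_congr rfl fun g _ => ?_
        rw [← Finset.mul_sum, hshift w g]; rfl
      have e2 : (∑ g, w g * f g) * (∑ g, w g * (r * ((χ g : ℤ) : ℝ))) =
          ∑ g, ∑ k, (w g * f g) * (w (g * k) * (r * ((χ (g * k) : ℤ) : ℝ))) := by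
        rw [Finset.sum_mul]
        refine Finset.sum_congr rfl fun g _ => ?_
        rw [← Finset.mul_sum, hshift (fun k => w k * (r * ((χ k : ℤ) : ℝ))) g]
      rw [e1, e2, ← Finset.sum_sub_distrib]
      simp only [← Finset.sum_sub_distrib, Finset.mul_sum]
      rw [Finset.sum_comm]
      refine Finset.sum_congr rfl fun k _ => Finset.sum_congr rfl fun g _ => ?_
      rw [map_mul, Units.val_mul, Int.cast_mul]
      ring
    rw [← sub_nonneg, key]
    refine Finset.sum_nonneg fun k _ => mul_nonneg (mul_nonneg hr ?_) ?_
    · rcases Int.units_eq_one_or (χ k) with h | h <;> norm_num [h]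
    · exact ((charCone_isingWeight_mul_shift s x h0 h1 k).mul
        (hf.mul (CharCone.char 1 zero_le_one χ))).sum_nonneg
  | add _ _ ih₁ ih₂ =>
    simp only [mul_add, Finset.sum_add_distrib]
    exact add_le_add ih₁ ih₂

/-- Correlation inequality for partition functions: the edge weights `u` may be lowered by the
factors `v` and `v'` separately or jointly. -/
theorem isingZ_mul_le [CommGroup G] [Fintype G] (x : ι → G →* ℤˣ) {u v v' : ι → ℝ}
    (hu : ∀ i, u i ∈ Set.Icc 0 1) (hv : ∀ i, v i ∈ Set.Icc 0 1) (hv' : ∀ i, v' i ∈ Set.Icc 0 1) :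
    isingZ s x (u * v) * isingZ s x (u * v') ≤ isingZ s x u * isingZ s x (u * (v * v')) := by
  simp only [isingZ, isingWeight_mul]
  -- The reference model has weights `u`; the reductions by `v` and `v'` are the two observables.
  exact ising_griffiths s x (fun i => (hu i).1) (fun i => (hu i).2)
    (charCone_isingWeight s x (fun i => (hv i).1) fun i => (hv i).2)
    (charCone_isingWeight s x (fun i => (hv' i).1) fun i => (hv' i).2)

/-- The Ising partition function is log-supermodular in the set of edges on which disagreements
are allowed. -/
theorem isingZ_indicator_mul_le [CommGroup G] [Fintype G] (x : ι → G →* ℤˣ) {t : ι → ℝ}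
    (ht : ∀ i, t i ∈ Set.Icc 0 1) (A B U I : Set ι) (hU : A ∪ B ⊆ U) (hI : A ∩ B ⊆ I) :
    isingZ s x (A.indicator t) * isingZ s x (B.indicator t) ≤
      isingZ s x (U.indicator t) * isingZ s x (I.indicator t) := by
  have hind : ∀ (C : Set ι) i, C.indicator (1 : ι → ℝ) i ∈ Set.Icc (0 : ℝ) 1 := fun C i => by
    by_cases h : i ∈ C <;> simp [h]
  have hindt : ∀ (C : Set ι) i, C.indicator t i ∈ Set.Icc (0 : ℝ) 1 := fun C i => by
    by_cases h : i ∈ C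
    · simpa [h] using ht i
    · simp [h]
  -- The reference model lives on `A ∪ B`; the 0/1 factors forbid disagreements outside `A` or
  -- outside `B`. The passage to `U` and `I` below only increases edge weights.
  have h := isingZ_mul_le s x (hindt (A ∪ B)) (hind A) (hind B)
  have eA : (A ∪ B).indicator t * A.indicator 1 = A.indicator t := by
    funext i; by_cases h : i ∈ A <;> simp [h]
  have eB : (A ∪ B).indicator t * B.indicator 1 = B.indicator t := by
    funext i; by_cases h : i ∈ B <;> simp [h]
  have eI : (A ∪ B).indicator t * (A.indicator 1 * B.indicator 1) = (A ∩ B).indicator t := by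
    funext i; by_cases h : i ∈ A <;> by_cases h' : i ∈ B <;> simp [h, h']
  rw [eA, eB, eI] at h
  have hmono : ∀ C C' : Set ι, C ⊆ C' →
      isingZ s x (C.indicator t) ≤ isingZ s x (C'.indicator t) := fun C C' hC =>
    isingZ_mono s x (fun i => (hindt C i).1)
      (Set.indicator_le_indicator_of_subset hC fun i => (ht i).1)
  exact h.trans (mul_le_mul (hmono _ _ hU) (hmono _ _ hI)
    (isingZ_nonneg s x fun i => (hindt _ i).1) (isingZ_nonneg s x fun i => (hindt _ i).1))

end Ising

/-! ### Discrete integration on the integers and on the grid. -/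

lemma exists_discrete_primitive (g : ℤ → ℤ) (r : ℤ) :
    ∃ F : ℤ → ℤ, F 0 = r ∧ ∀ n, F (n + 1) = F n + g n := by
  -- Truncation by `toNat` makes one of the two sums empty, according to the sign of `n`.
  refine ⟨fun n => r + ∑ k ∈ Finset.range n.toNat, g k -
    ∑ k ∈ Finset.range (-n).toNat, g (-k - 1), by simp, fun n => ?_⟩
  rcases le_or_gt 0 n with h | h
  · obtain ⟨m, rfl⟩ := Int.eq_ofNat_of_zero_le h
    have e1 : ((m : ℤ) + 1).toNat = m + 1 := by omega
    have e2 : (-((m : ℤ) + 1)).toNat = 0 := by omega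
    have e3 : (-(m : ℤ)).toNat = 0 := by omega
    simp only [e1, e2, e3, Int.toNat_natCast, Finset.sum_range_succ, Finset.range_zero,
      Finset.sum_empty]
    ring
  · obtain ⟨m, hm⟩ := Int.eq_ofNat_of_zero_le (show 0 ≤ -n - 1 by omega)
    have e1 : (n + 1).toNat = 0 := by omega
    have e2 : (-(n + 1)).toNat = m := by omega
    have e3 : (-n).toNat = m + 1 := by omega
    have e4 : n.toNat = 0 := by omega
    have e5 : -(m : ℤ) - 1 = n := by omega
    simp only [e1, e2, e3, e4, e5, Finset.sum_range_succ, Finset.range_zero, Finset.sum_empty]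
    ring

lemma int_forall_of_step {p : ℤ → Prop} (h0 : p 0) (h : ∀ n, p n ↔ p (n + 1)) (n : ℤ) : p n := by
  induction n using Int.induction_on with
  | zero => exact h0
  | succ n ih => exact (h _).1 ih
  | pred n ih => exact (h _).2 (by simpa using ih)

/-- The field is integrated along the row 0 and then along columns; the curl condition carries the
horizontal relation from each row to its neighbours. -/
lemma exists_discrete_potential (dx dy : ℤ × ℤ → ℤ)
    (hcurl : ∀ i j, dx (i, j) + dy (i + 1, j) = dy (i, j) + dx (i, j + 1)) :
    ∃ h : ℤ × ℤ → ℤ, (∀ i j, h (i + 1, j) = h (i, j) + dx (i, j)) ∧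
      ∀ i j, h (i, j + 1) = h (i, j) + dy (i, j) := by
  obtain ⟨F, -, hF⟩ := exists_discrete_primitive (fun i => dx (i, 0)) 0
  choose H hH0 hH using fun i => exists_discrete_primitive (fun j => dy (i, j)) (F i)
  refine ⟨fun u => H u.1 u.2, fun i j => ?_, fun i j => hH i j⟩
  refine int_forall_of_step (p := fun j => H (i + 1) j = H i j + dx (i, j)) ?_ (fun j => ?_) j
  · simp only [hH0, hF]
  · have h1 := hH (i + 1) j
    have h2 := hH i j
    have h3 := hcurl i j
    constructor <;> intro h <;> linarith

/-! ### Connectedness of the exterior of a domain. -/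

namespace SixVertex

lemma grid_forall_of_step {p : Face → Prop} (u : Face) (h0 : p u)
    (hx : ∀ i j, p (i, j) ↔ p (i + 1, j)) (hy : ∀ i j, p (i, j) ↔ p (i, j + 1)) (v : Face) :
    p v := by
  have step : ∀ {q : ℤ → Prop}, (∀ n, q n ↔ q (n + 1)) → ∀ m n, q m → q n := by
    intro q hq m n hm
    have := int_forall_of_step (p := fun k => q (m + k)) (by simpa using hm)
      (fun k => by rw [← add_assoc]; exact hq _) (n - m)
    simpa using this
  obtain ⟨i, j⟩ := u
  obtain ⟨k, l⟩ := v
  have h1 : p (k, j) := step (q := fun n => p (n, j)) (fun n => hx n j) i k h0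
  exact step (q := fun n => p (k, n)) (fun n => hy k n) j l h1

namespace Domain

variable (D : Domain)

lemma notMem_faces_of_reachable {u v : Face}
    (h : (facesOff {e | e ∈ D.boundary.edges}).Reachable u v) (hu : u ∉ D.faces) :
    v ∉ D.faces := by
  intro hv
  refine hu (Set.Finite.subset hv fun w hw => ?_)
  exact h.symm.trans hw

/-- The faces outside of a domain are connected to each other. -/
lemma exists_forall_reachable : ∃ u₀ : Face, Odd (u₀.1 + u₀.2) ∧ u₀ ∉ D.faces ∧
    ∀ u, u ∉ D.faces → (facesOff {e | e ∈ D.boundary.edges}).Reachable u₀ u := by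
  obtain ⟨N, hN⟩ := D.exists_bound
  set H := facesOff {e | e ∈ D.boundary.edges} with hH
  have key : ∀ z w : Vertex, (N < |z.1| ∨ N < |z.2|) →
      s(z, w) ∉ {e | e ∈ D.boundary.edges} := by
    intro z w hz hmem
    have := hN z (D.boundary.fst_mem_support_of_mem_edges hmem)
    omega
  have hor : ∀ i j : ℤ, N + 1 < |j| → H.Reachable (i, j) (i + 1, j) := by
    intro i j hj
    refine SimpleGraph.Adj.reachable ⟨by simp, (i, j), (i, j - 1), by simp [lattice],
      key _ _ (Or.inr (by simp only; omega)), ?_⟩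
    simp [Borders, sw, se, nw, ne, Prod.ext_iff]
  have ver : ∀ i j : ℤ, N + 1 < |i| → H.Reachable (i, j) (i, j + 1) := by
    intro i j hi
    refine SimpleGraph.Adj.reachable ⟨by simp, (i, j), (i - 1, j), by simp [lattice],
      key _ _ (Or.inl (by simp only; omega)), ?_⟩
    simp [Borders, sw, se, nw, ne, Prod.ext_iff]
  have step : ∀ f : ℤ → Face, (∀ n, H.Reachable (f n) (f (n + 1))) →
      ∀ m n, H.Reachable (f m) (f n) := by
    intro f hf m n
    have := int_forall_of_step (p := fun k => H.Reachable (f m) (f (m + k)))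
      (by simp) (fun k => by
        rw [← add_assoc]
        exact ⟨fun h => h.trans (hf _), fun h => h.trans (hf _).symm⟩) (n - m)
    simpa using this
  have horAll : ∀ j i k : ℤ, N + 1 < |j| → H.Reachable (i, j) (k, j) := fun j i k hj =>
    step (fun n => (n, j)) (fun n => hor n j hj) i k
  have verAll : ∀ i j k : ℤ, N + 1 < |i| → H.Reachable (i, j) (i, k) := fun i j k hi =>
    step (fun n => (i, n)) (fun n => ver i n hi) j k
  -- Both `M` and `M + 1` lie beyond the box containing the boundary, and the base face `(M, M + 1)`
  -- is odd.
  set M : ℤ := |N| + 2 with hM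
  have hMa : N + 1 < |M| := by
    have := le_abs_self N; have := le_abs_self M; omega
  have hMb : N + 1 < |M + 1| := by
    have := le_abs_self N; have := le_abs_self (M + 1); omega
  have far : ∀ u : Face, (N + 1 < |u.1| ∨ N + 1 < |u.2|) → H.Reachable (M, M + 1) u := by
    rintro ⟨i, j⟩ (h | h)
    · exact (horAll (M + 1) M i hMb).trans (verAll i (M + 1) j h)
    · exact (verAll M (M + 1) j hMa).trans (horAll j M i h)
  have fin : {u : Face | ¬ (N + 1 < |u.1| ∨ N + 1 < |u.2|)}.Finite := by
    apply (Set.finite_Icc ((-N - 1, -N - 1) : ℤ × ℤ) (N + 1, N + 1)).subset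
    rintro ⟨i, j⟩ hu
    simp only [Set.mem_ofPred_eq, not_or, not_lt, abs_le] at hu
    exact ⟨⟨by simp only; omega, by simp only; omega⟩, ⟨by simp only; omega, by simp only; omega⟩⟩
  refine ⟨(M, M + 1), ⟨M, by simp only; ring⟩, fun h => ?_, fun u hu => ?_⟩
  · have hinf : {u : Face | N + 1 < |u.1| ∨ N + 1 < |u.2|}.Infinite := by
      refine fin.infinite_compl.mono fun u hu => ?_
      simpa only [Set.mem_compl_iff, Set.mem_ofPred_eq, not_not] using hu
    exact hinf (Set.Finite.subset h fun u hu => far u hu)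
  -- An exterior face reaches infinitely many faces, hence one beyond the box, where all faces are
  -- connected. No form of the Jordan curve theorem is needed.
  · obtain ⟨v, hv, hv'⟩ : ∃ v, H.Reachable u v ∧ (N + 1 < |v.1| ∨ N + 1 < |v.2|) := by
      by_contra hcon
      push Not at hcon
      exact hu (fin.subset fun v hv => by
        have := hcon v hv
        simp only [Set.mem_ofPred_eq, not_or, not_lt]; exact this)
    exact (far v hv').trans hv.symm

end Domain

lemma borders_iff {z : Vertex} {u : Face} :
    Borders z u ↔ (z.1 ≤ u.1 ∧ u.1 ≤ z.1 + 1) ∧ z.2 ≤ u.2 ∧ u.2 ≤ z.2 + 1 := by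
  obtain ⟨z1, z2⟩ := z
  obtain ⟨u1, u2⟩ := u
  simp only [Borders, sw, se, nw, ne, Prod.mk.injEq]
  constructor
  · rintro (h | h | h | h) <;> omega
  · intro h
    omega

/-- Faces separated by an edge are horizontal or vertical neighbours. -/
lemma neighbours_of_facesOff_adj {S : Set (Sym2 Vertex)} {u v : Face} (h : (facesOff S).Adj u v) :
    v = (u.1 + 1, u.2) ∨ u = (v.1 + 1, v.2) ∨ v = (u.1, u.2 + 1) ∨ u = (v.1, v.2 + 1) := by
  obtain ⟨hne, ⟨z1, z2⟩, ⟨w1, w2⟩, hadj, -, h1, h2, h3, h4⟩ := h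
  obtain ⟨u1, u2⟩ := u
  obtain ⟨v1, v2⟩ := v
  have hadj' : |z1 - w1| + |z2 - w2| = 1 := hadj
  have hzw : (z1 - w1 = 1 ∨ z1 - w1 = -1) ∧ z2 = w2 ∨
      (z2 - w2 = 1 ∨ z2 - w2 = -1) ∧ z1 = w1 := by
    rcases abs_cases (z1 - w1) with h | h <;> rcases abs_cases (z2 - w2) with h' | h' <;> omega
  simp only [borders_iff] at h1 h2 h3 h4
  have hne' : u1 ≠ v1 ∨ u2 ≠ v2 := by
    by_contra h
    push Not at h
    exact hne (by rw [h.1, h.2])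
  simp only [Prod.mk.injEq]
  clear hadj hadj' hne
  have hu : |u1 - v1| ≤ 1 ∧ |u2 - v2| ≤ 1 ∧ (u1 = v1 ∨ u2 = v2) := by
    simp only [abs_le]
    rcases hzw with h | h <;> omega
  simp only [abs_le] at hu
  omega

end SixVertex

/-! ### Height functions and the separation of odd disagreements. -/

namespace SixVertex

/-- The first odd face at a vertex. -/
def odd₁ (z : Vertex) : Face := if Even (z.1 + z.2) then se z else sw z
/-- The second odd face at a vertex. -/
def odd₂ (z : Vertex) : Face := if Even (z.1 + z.2) then nw z else ne z
/-- The first even face at a vertex. -/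
def even₁ (z : Vertex) : Face := if Even (z.1 + z.2) then sw z else se z
/-- The second even face at a vertex. -/
def even₂ (z : Vertex) : Face := if Even (z.1 + z.2) then ne z else nw z

lemma odd_odd₁ (z : Vertex) : Odd ((odd₁ z).1 + (odd₁ z).2) := by
  unfold odd₁ se sw
  split_ifs with h
  · simp only; rw [Int.odd_iff]; rw [Int.even_iff] at h; omega
  · exact Int.not_even_iff_odd.1 h

lemma odd_odd₂ (z : Vertex) : Odd ((odd₂ z).1 + (odd₂ z).2) := by
  unfold odd₂ nw ne
  split_ifs with h <;> simp only <;> rw [Int.odd_iff] <;> rw [Int.even_iff] at h <;> omega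

lemma even_even₁ (z : Vertex) : Even ((even₁ z).1 + (even₁ z).2) := by
  unfold even₁ se sw
  split_ifs with h
  · exact h
  · simp only; rw [Int.even_iff]; rw [Int.even_iff] at h; omega

lemma even_even₂ (z : Vertex) : Even ((even₂ z).1 + (even₂ z).2) := by
  unfold even₂ nw ne
  split_ifs with h <;> simp only <;> rw [Int.even_iff] <;> rw [Int.even_iff] at h <;> omega

lemma iceRule_iff {σ : SpinConfig} :
    IceRule σ ↔ ∀ z, σ (odd₁ z) = σ (odd₂ z) ∨ σ (even₁ z) = σ (even₂ z) := by
  refine forall_congr' fun z => ?_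
  unfold odd₁ odd₂ even₁ even₂
  split_ifs
  · rw [or_comm, eq_comm (a := σ (nw z))]
  · rw [eq_comm (a := σ (nw z))]

/-- The sign of the height gradient when leaving a face. -/
def paritySign (u : Face) : ℤ := if Even (u.1 + u.2) then 1 else -1

lemma paritySign_right (i j : ℤ) : paritySign (i + 1, j) = -paritySign (i, j) := by
  have : Even (i + 1 + j) ↔ ¬ Even (i + j) := by
    rw [show i + 1 + j = i + j + 1 by ring, Int.even_add_one]
  simp only [paritySign, this]
  split_ifs <;> simp_all

lemma paritySign_up (i j : ℤ) : paritySign (i, j + 1) = -paritySign (i, j) := by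
  have : Even (i + (j + 1)) ↔ ¬ Even (i + j) := by
    rw [← add_assoc, Int.even_add_one]
  simp only [paritySign, this]
  split_ifs <;> simp_all

/-- The six-vertex height function of a spin configuration. -/
lemma exists_height {σ : SpinConfig} (hσ : IceRule σ) :
    ∃ h : Face → ℤ,
      (∀ i j, h (i + 1, j) = h (i, j) + paritySign (i, j) * (σ (i, j) * σ (i + 1, j))) ∧
      ∀ i j, h (i, j + 1) = h (i, j) + paritySign (i, j) * (σ (i, j) * σ (i, j + 1)) := by
  refine exists_discrete_potential
    (fun u => paritySign u * (σ u * σ (u.1 + 1, u.2)))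
    (fun u => paritySign u * (σ u * σ (u.1, u.2 + 1))) fun i j => ?_
  simp only [paritySign_right, paritySign_up]
  -- The curl around a vertex vanishes iff `(σ sw - σ ne) * (σ se - σ nw) = 0`, which is the ice
  -- rule.
  have := hσ (i, j)
  simp only [sw, se, ne, nw] at this
  rcases this with h | h
  · rw [h]
    ring
  · rw [h]

/-- The residue modulo four that the height of a face should have, given its spin. -/
def spinResidue (σ : SpinConfig) (u : Face) : ℤ :=
  if Even (u.1 + u.2) then 1 - σ u else σ u

/-- The difference is `± (1 - σ u) * (1 - σ v)`. It is therefore 0 or ±4, and it vanishes when one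
of the spins is 1. -/
lemma spinResidue_step {σ : SpinConfig} {u v : Face} (huv : Even (v.1 + v.2) ↔ ¬ Even (u.1 + u.2)) :
    (4 : ℤ) ∣ spinResidue σ v - (spinResidue σ u + paritySign u * (σ u * σ v)) := by
  unfold spinResidue paritySign
  simp only [huv]
  by_cases h : Even (u.1 + u.2) <;> rcases Int.units_eq_one_or (σ u) with h1 | h1 <;>
    rcases Int.units_eq_one_or (σ v) with h2 | h2 <;> simp [h, h1, h2]

lemma ite_neg_one_eq_iff (p q : Prop) [Decidable p] [Decidable q] :
    ((if p then -1 else 1 : ℤˣ) = if q then -1 else 1) ↔ (p ↔ q) := by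
  by_cases hp : p <;> by_cases hq : q <;> simp [hp, hq]

/-- The disagreements of the odd spins at vertices whose even spins are `1` are the disagreements
of an odd spin configuration with the same boundary values. -/
theorem exists_odd_restriction (D : Domain) {σ : SpinConfig} (hσ : IceRule σ)
    (hodd : ∀ u : Face, Odd (u.1 + u.2) → u ∉ D.faces → σ u = 1) :
    ∃ ξ : SpinConfig, (∀ u, ¬ (Odd (u.1 + u.2) ∧ u ∈ D.faces) → ξ u = 1) ∧
      ∀ z, ξ (odd₁ z) = ξ (odd₂ z) ↔ (σ (even₁ z) = 1 → σ (odd₁ z) = σ (odd₂ z)) := by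
  obtain ⟨h', hx', hy'⟩ := exists_height hσ
  obtain ⟨u₀, hu₀, hu₀D, hreach⟩ := D.exists_forall_reachable
  obtain ⟨h, hx, hy, hh₀⟩ : ∃ h : Face → ℤ,
      (∀ i j, h (i + 1, j) = h (i, j) + paritySign (i, j) * (σ (i, j) * σ (i + 1, j))) ∧
      (∀ i j, h (i, j + 1) = h (i, j) + paritySign (i, j) * (σ (i, j) * σ (i, j + 1))) ∧
      h u₀ = 1 := by
    refine ⟨fun u => h' u - h' u₀ + 1, fun i j => ?_, fun i j => ?_, by simp⟩
    · simp only [hx']; ring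
    · simp only [hy']; ring
  have hres : ∀ u, (4 : ℤ) ∣ h u - spinResidue σ u := by
    refine grid_forall_of_step (p := fun u => (4 : ℤ) ∣ h u - spinResidue σ u) u₀ ?_
      (fun i j => ?_) fun i j => ?_
    · simp [spinResidue, hh₀, Int.not_even_iff_odd.2 hu₀, hodd u₀ hu₀ hu₀D]
    · have := spinResidue_step (σ := σ) (u := (i, j)) (v := (i + 1, j))
        (by simp only; rw [show i + 1 + j = i + j + 1 by ring, Int.even_add_one])
      simp only [hx]
      omega
    · have := spinResidue_step (σ := σ) (u := (i, j)) (v := (i, j + 1))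
        (by simp only; rw [← add_assoc, Int.even_add_one])
      simp only [hy]
      omega
  -- Outside the domain the congruence is an equality: of two neighbouring faces one is odd and has
  -- spin 1, so no multiple of 4 is picked up along exterior paths.
  have hout : ∀ u, u ∉ D.faces → h u = spinResidue σ u := by
    have hstep : ∀ u v : Face, (Even (v.1 + v.2) ↔ ¬ Even (u.1 + u.2)) → u ∉ D.faces →
        v ∉ D.faces → h v = h u + paritySign u * (σ u * σ v) →
        (h u = spinResidue σ u ↔ h v = spinResidue σ v) := by
      intro u v huv hu hv hs
      have : spinResidue σ v = spinResidue σ u + paritySign u * (σ u * σ v) := by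
        unfold spinResidue paritySign
        simp only [huv]
        by_cases he : Even (u.1 + u.2)
        · simp [he, hodd v (Int.not_even_iff_odd.1 fun h => huv.1 h he) hv]
        · simp [he, hodd u (Int.not_even_iff_odd.1 he) hu]; ring
      rw [hs, this]
      exact add_left_inj _ |>.symm
    intro u hu
    have hr := hreach u hu
    rw [SimpleGraph.reachable_iff_reflTransGen] at hr
    have : u ∉ D.faces ∧ h u = spinResidue σ u := by
      induction hr with
      | refl =>
        exact ⟨hu₀D, by simp [spinResidue, hh₀, Int.not_even_iff_odd.2 hu₀, hodd u₀ hu₀ hu₀D]⟩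
      | @tail v w hv hvw ih =>
        have hv' : v ∉ D.faces := D.notMem_faces_of_reachable
          ((SimpleGraph.reachable_iff_reflTransGen _ _).2 hv) hu₀D
        have hw' : w ∉ D.faces := D.notMem_faces_of_reachable hvw.reachable hv'
        refine ⟨hw', ?_⟩
        have ihv := (ih hv').2
        obtain ⟨v1, v2⟩ := v
        obtain ⟨w1, w2⟩ := w
        have right : ∀ i j : ℤ, Even (i + 1 + j) ↔ ¬ Even (i + j) := fun i j => by
          rw [show i + 1 + j = i + j + 1 by ring, Int.even_add_one]
        have up : ∀ i j : ℤ, Even (i + (j + 1)) ↔ ¬ Even (i + j) := fun i j => by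
          rw [← add_assoc, Int.even_add_one]
        rcases neighbours_of_facesOff_adj hvw with e | e | e | e <;>
          simp only [Prod.mk.injEq] at e <;> obtain ⟨rfl, rfl⟩ := e
        · exact (hstep _ _ (right _ _) hv' hw' (hx _ _)).1 ihv
        · exact (hstep _ _ (right _ _) hw' hv' (hx _ _)).2 ihv
        · exact (hstep _ _ (up _ _) hv' hw' (hy _ _)).1 ihv
        · exact (hstep _ _ (up _ _) hw' hv' (hy _ _)).2 ihv
    exact this.2
  have hgrad : ∀ z, h (odd₁ z) = h (even₁ z) + σ (even₁ z) * σ (odd₁ z) ∧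
      h (odd₂ z) = h (even₁ z) + σ (even₁ z) * σ (odd₂ z) := by
    rintro ⟨i, j⟩
    have h1 := hx i j
    have h2 := hx i (j + 1)
    have h3 := hy i j
    have h4 := hy (i + 1) j
    rw [paritySign_up] at h2
    rw [paritySign_right] at h4
    unfold odd₁ odd₂ even₁ sw se nw ne
    unfold paritySign at h1 h2 h3 h4
    split_ifs with he <;> simp only [he, if_true, if_false] at h1 h2 h3 h4 <;> simp only
    · exact ⟨by linarith, by linarith⟩
    · exact ⟨by linarith, by linarith⟩
  -- Odd heights 1, 3 modulo 8 get spin 1 and 5, 7 get spin -1. The sign flips only across a height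
  -- divisible by 4, that is, at even faces of spin 1; across heights 2 modulo 4 it is kept.
  refine ⟨fun u => if Odd (u.1 + u.2) ∧ ¬ Even (h u / 4) then -1 else 1, fun u hu => ?_,
    fun z => ?_⟩
  · by_cases ho : Odd (u.1 + u.2)
    · have huD : u ∉ D.faces := fun h => hu ⟨ho, h⟩
      have : h u = 1 := by
        rw [hout u huD]
        simp [spinResidue, Int.not_even_iff_odd.2 ho, hodd u ho huD]
      simp [this]
    · simp [ho]
  · obtain ⟨g1, g2⟩ := hgrad z
    have hne : (1 : ℤˣ) ≠ -1 := by decide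
    have hr := hres (even₁ z)
    simp only [spinResidue, even_even₁, if_true] at hr
    simp only [odd_odd₁, odd_odd₂, true_and, g1, g2]
    generalize h (even₁ z) = k at *
    rcases Int.units_eq_one_or (σ (even₁ z)) with h0 | h0 <;>
    rcases Int.units_eq_one_or (σ (odd₁ z)) with h1 | h1 <;>
    rcases Int.units_eq_one_or (σ (odd₂ z)) with h2 | h2 <;>
    simp only [h0, h1, h2, Units.val_one, Units.val_neg, mul_one, mul_neg, neg_neg,
      Int.even_iff, ite_neg_one_eq_iff, true_imp_iff, hne, hne.symm, iff_false, false_imp_iff, iff_true] at hr ⊢ <;>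
    omega

end SixVertex

/-! ### The odd spins as an Ising model. -/

namespace SixVertex

/-- The group of odd spin configurations that are trivial outside of the domain. -/
def oddGroup (D : Domain) : Subgroup SpinConfig where
  carrier := {ξ | ∀ u, ¬ (Odd (u.1 + u.2) ∧ u ∈ D.faces) → ξ u = 1}
  mul_mem' {ξ ξ'} h h' u hu := by simp [h u hu, h' u hu]
  one_mem' _ _ := rfl
  inv_mem' {ξ} h u hu := by simp [h u hu]

instance (D : Domain) : Finite (oddGroup D) := by
  have : Finite D.faces := D.finite_faces
  refine Finite.of_injective (fun (ξ : oddGroup D) (u : D.faces) => ξ.1 u) fun ξ ξ' h => ?_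
  ext1
  funext u
  by_cases hu : u ∈ D.faces
  · exact congrFun h ⟨u, hu⟩
  · rw [ξ.2 u fun h => hu h.2, ξ'.2 u fun h => hu h.2]

noncomputable instance (D : Domain) : Fintype (oddGroup D) := Fintype.ofFinite _

/-- The product of the two odd spins at a vertex. -/
def oddEdge (D : Domain) (z : Vertex) : oddGroup D →* ℤˣ where
  toFun ξ := ξ.1 (odd₁ z) * ξ.1 (odd₂ z)
  map_one' := by simp
  map_mul' ξ ξ' := by simp [mul_mul_mul_comm]

lemma oddEdge_eq_one_iff {D : Domain} {z : Vertex} {ξ : oddGroup D} :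
    oddEdge D z ξ = 1 ↔ ξ.1 (odd₁ z) = ξ.1 (odd₂ z) := by
  change ξ.1 (odd₁ z) * ξ.1 (odd₂ z) = 1 ↔ _
  rw [mul_eq_one_iff_eq_inv, Int.units_inv_eq_self]

lemma oddEdge_eq_one_of_notMem {D : Domain} {z : Vertex} (hz : z ∉ D.vertices) (ξ : oddGroup D) :
    oddEdge D z ξ = 1 := by
  have h : ∀ u, Borders z u → ξ.1 u = 1 := fun u hu =>
    ξ.2 u fun h => hz (Or.inr ⟨u, h.2, hu⟩)
  rw [oddEdge_eq_one_iff, h, h]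
  · unfold odd₂ Borders; split_ifs <;> simp
  · unfold odd₁ Borders; split_ifs <;> simp

/-- Agreement propagates along the diagonal of odd faces, which leaves the finite domain. -/
lemma eq_one_of_oddEdge {D : Domain} {ξ : oddGroup D} (h : ∀ z, oddEdge D z ξ = 1) : ξ = 1 := by
  ext1
  funext u
  by_cases hu : Odd (u.1 + u.2)
  swap
  · exact ξ.2 u fun h => hu h.1
  have hstep : ∀ k : ℕ, ξ.1 (u.1 + k, u.2 + k) = ξ.1 u := by
    intro k
    induction k with
    | zero => simp
    | succ k ih =>
      have hk := oddEdge_eq_one_iff.1 (h (u.1 + k, u.2 + k))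
      have he : ¬ Even (u.1 + (k : ℤ) + (u.2 + k)) := by
        rw [Int.odd_iff] at hu
        rw [Int.even_iff]
        omega
      simp only [odd₁, odd₂, he, if_false, sw, ne] at hk
      rw [← ih, hk]
      push_cast
      simp only [add_assoc]
  obtain ⟨k, hk⟩ : ∃ k : ℕ, ((u.1 + k, u.2 + k) : Face) ∉ D.faces := by
    by_contra hcon
    push Not at hcon
    refine Set.infinite_of_injective_forall_mem (f := fun k : ℕ => ((u.1 + k, u.2 + k) : Face))
      (fun k l hkl => ?_) hcon D.finite_faces
    simpa using hkl
  rw [← hstep k]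
  exact ξ.2 _ fun h => hk h.2

/-- The extension of an even spin configuration by `1` on the odd faces. -/
def evenExt (η : EvenFace → ℤˣ) : SpinConfig := fun u =>
  if h : Even (u.1 + u.2) then η ⟨u, h⟩ else 1

lemma evenExt_even₁ (η : EvenFace → ℤˣ) (z : Vertex) :
    evenExt η (even₁ z) = η ⟨even₁ z, even_even₁ z⟩ :=
  dif_pos _

lemma evenExt_even₂ (η : EvenFace → ℤˣ) (z : Vertex) :
    evenExt η (even₂ z) = η ⟨even₂ z, even_even₂ z⟩ :=
  dif_pos _

section Glue

variable {D : Domain} (η : EvenFace → ℤˣ) (ξ : oddGroup D)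

lemma glue_of_even {u : Face} (hu : Even (u.1 + u.2)) :
    (evenExt η * ξ.1) u = η ⟨u, hu⟩ := by
  simp [evenExt, hu, ξ.2 u fun h => Int.not_even_iff_odd.2 h.1 hu]

lemma glue_of_odd {u : Face} (hu : Odd (u.1 + u.2)) : (evenExt η * ξ.1) u = ξ.1 u := by
  simp [evenExt, Int.not_even_iff_odd.2 hu]

lemma evenPart_glue : evenPart (evenExt η * ξ.1) = η :=
  funext fun u => glue_of_even η ξ u.2

/-- The vertices whose even spins agree. -/
def evenAgree : Set Vertex := {z | evenExt η (even₁ z) = evenExt η (even₂ z)}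

/-- The vertices whose even spins are both equal to `s`. -/
def evenEq (s : ℤˣ) : Set Vertex := {z | evenExt η (even₁ z) = s ∧ evenExt η (even₂ z) = s}

lemma glue_even₁ (z : Vertex) : (evenExt η * ξ.1) (even₁ z) = evenExt η (even₁ z) := by
  rw [glue_of_even η ξ (even_even₁ z), evenExt_even₁]

lemma glue_even₂ (z : Vertex) : (evenExt η * ξ.1) (even₂ z) = evenExt η (even₂ z) := by
  rw [glue_of_even η ξ (even_even₂ z), evenExt_even₂]

lemma iceRule_glue : IceRule (evenExt η * ξ.1) ↔ ∀ z, oddEdge D z ξ ≠ 1 → z ∈ evenAgree η := by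
  rw [iceRule_iff]
  refine forall_congr' fun z => ?_
  rw [glue_of_odd η ξ (odd_odd₁ z), glue_of_odd η ξ (odd_odd₂ z), glue_even₁, glue_even₂,
    Ne, oddEdge_eq_one_iff, or_iff_not_imp_left]
  exact Iff.rfl

end Glue

lemma isingWeight_indicator_eq_zero {D : Domain} {A : Set Vertex} {ξ : oddGroup D}
    (h : ¬ ∀ z, oddEdge D z ξ ≠ 1 → z ∈ A) (t : Vertex → ℝ) :
    isingWeight D.finite_vertices.toFinset (oddEdge D) (A.indicator t) ξ = 0 := by
  push Not at h
  obtain ⟨z, hz, hzA⟩ := h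
  refine Finset.prod_eq_zero (i := z) ?_ (by simp [hz, hzA])
  rw [Set.Finite.mem_toFinset]
  by_contra hcon
  exact hz (oddEdge_eq_one_of_notMem hcon ξ)

lemma mem_evenAgree_of_mem_evenEq {η : EvenFace → ℤˣ} {s : ℤˣ} {z : Vertex}
    (h : z ∈ evenEq η s) : z ∈ evenAgree η :=
  h.1.trans h.2.symm

lemma notMem_evenEq_neg_one {η : EvenFace → ℤˣ} {z : Vertex} (h : z ∈ evenEq η 1) :
    z ∉ evenEq η (-1) := fun h' => absurd (h.1.symm.trans h'.1) (by decide)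

open scoped Classical in
/-- Given the even spins, the partition function of the odd spins is the product of those for the
edges between positive even faces and for the edges between negative even faces. -/
theorem isingZ_evenAgree (D : Domain) (η : EvenFace → ℤˣ) (t : Vertex → ℝ) :
    isingZ D.finite_vertices.toFinset (oddEdge D) ((evenAgree η).indicator t) =
      isingZ D.finite_vertices.toFinset (oddEdge D) ((evenEq η 1).indicator t) *
        isingZ D.finite_vertices.toFinset (oddEdge D) ((evenEq η (-1)).indicator t) := by
  have hrestrict : ∀ A : Set Vertex,
      isingZ D.finite_vertices.toFinset (oddEdge D) (A.indicator t) =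
        ∑ ξ with ∀ z, oddEdge D z ξ ≠ 1 → z ∈ A,
          isingWeight D.finite_vertices.toFinset (oddEdge D) (A.indicator t) ξ := fun A =>
    (Finset.sum_filter_of_ne fun ξ _ h => by
      by_contra hcon
      exact h (isingWeight_indicator_eq_zero hcon t)).symm
  rw [hrestrict, hrestrict, hrestrict, Finset.sum_mul_sum, ← Finset.sum_product']
  symm
  refine Finset.sum_bij (fun p _ => p.1 * p.2) ?_ ?_ ?_ ?_
  · rintro ⟨ξ, ξ'⟩ h
    simp only [Finset.mem_product, Finset.mem_filter, Finset.mem_univ, true_and] at h ⊢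
    intro z hz
    by_cases h1 : oddEdge D z ξ = 1
    · exact mem_evenAgree_of_mem_evenEq (h.2 z fun h2 => hz (by simp [h1, h2]))
    · exact mem_evenAgree_of_mem_evenEq (h.1 z h1)
  · rintro ⟨ξ₁, ξ₁'⟩ h₁ ⟨ξ₂, ξ₂'⟩ h₂ he
    simp only [Finset.mem_product, Finset.mem_filter, Finset.mem_univ, true_and] at h₁ h₂ he
    have he' : ξ₂⁻¹ * ξ₁ = ξ₂' * ξ₁'⁻¹ := by
      rw [inv_mul_eq_iff_eq_mul, ← mul_assoc, ← he, mul_inv_cancel_right]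
    -- By `he'` this element can disagree only at edges between positive faces and only at edges
    -- between negative faces, hence nowhere.
    have hone : ξ₂⁻¹ * ξ₁ = 1 := by
      refine eq_one_of_oddEdge fun z => ?_
      by_cases hz : z ∈ evenEq η 1
      · have hz' := notMem_evenEq_neg_one hz
        have e1 : oddEdge D z ξ₁' = 1 := by
          by_contra h; exact hz' (h₁.2 z h)
        have e2 : oddEdge D z ξ₂' = 1 := by
          by_contra h; exact hz' (h₂.2 z h)
        rw [he', map_mul, map_inv, e1, e2]; simp
      · have e1 : oddEdge D z ξ₁ = 1 := by
          by_contra h; exact hz (h₁.1 z h)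
        have e2 : oddEdge D z ξ₂ = 1 := by
          by_contra h; exact hz (h₂.1 z h)
        rw [map_mul, map_inv, e1, e2]; simp
    have h1 : ξ₁ = ξ₂ := (inv_mul_eq_one.1 hone).symm
    subst h1
    simpa using he
  · intro ξ hξ
    simp only [Finset.mem_filter, Finset.mem_univ, true_and] at hξ
    obtain ⟨ζ, hζ, hζ'⟩ := exists_odd_restriction D ((iceRule_glue η ξ).2 hξ) fun u hu huD => by
      rw [glue_of_odd η ξ hu]
      exact ξ.2 u fun h => huD h.2
    set ζ₀ : oddGroup D := ⟨ζ, hζ⟩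
    have key : ∀ z, oddEdge D z ζ₀ = 1 ↔ (evenExt η (even₁ z) = 1 → oddEdge D z ξ = 1) := by
      intro z
      have := hζ' z
      rwa [glue_of_odd η ξ (odd_odd₁ z), glue_of_odd η ξ (odd_odd₂ z), glue_even₁,
        ← oddEdge_eq_one_iff, ← oddEdge_eq_one_iff (ξ := ζ₀)] at this
    -- `ζ₀` carries the disagreements of `ξ` at positive even faces; the quotient keeps those at
    -- negative ones.
    refine ⟨(ζ₀, ζ₀⁻¹ * ξ), ?_, by simp⟩
    simp only [Finset.mem_product, Finset.mem_filter, Finset.mem_univ, true_and]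
    refine ⟨fun z hz => ?_, fun z hz => ?_⟩
    · rw [Ne, key, Classical.not_imp] at hz
      exact ⟨hz.1, (hξ z hz.2).symm.trans hz.1⟩
    · have hξz : oddEdge D z ξ ≠ 1 := fun h => hz (by
        rw [map_mul, map_inv, h, (key z).2 fun _ => h]; simp)
      have hne : evenExt η (even₁ z) ≠ 1 := by
        intro h
        have h1 : oddEdge D z ζ₀ ≠ 1 := fun h' => hξz ((key z).1 h' h)
        refine hz ?_
        rw [map_mul, map_inv, (Int.units_eq_one_or _).resolve_left h1,
          (Int.units_eq_one_or _).resolve_left hξz]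
        simp
      have h1 := (Int.units_eq_one_or _).resolve_left hne
      exact ⟨h1, (hξ z hξz).symm.trans h1⟩
  · rintro ⟨ξ, ξ'⟩ h
    simp only [Finset.mem_product, Finset.mem_filter, Finset.mem_univ, true_and] at h
    unfold isingWeight
    rw [← Finset.prod_mul_distrib]
    refine Finset.prod_congr rfl fun z _ => ?_
    by_cases h1 : oddEdge D z ξ = 1 <;> by_cases h2 : oddEdge D z ξ' = 1
    · simp [h1, h2]
    · have := h.2 z h2
      simp [h1, h2, this, mem_evenAgree_of_mem_evenEq this]
    · have := h.1 z h1
      simp [h1, h2, this, mem_evenAgree_of_mem_evenEq this]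
    · exact absurd (h.2 z h2) (notMem_evenEq_neg_one (h.1 z h1))

/-! ### Local weights and the formula for the even marginal. -/

open scoped Classical in
/-- The weight of a single vertex. -/
noncomputable def localWeight (a b c : ℝ) (σ : SpinConfig) (z : Vertex) : ℝ :=
  if IsTypeA σ z then a else if IsTypeB σ z then b else if IsTypeC σ z then c else 1

lemma weight_eq_prod (D : Domain) (a b c : ℝ) (σ : SpinConfig) :
    weight D a b c σ = ∏ z ∈ D.finite_vertices.toFinset, localWeight a b c σ z := by
  classical
  have hpow : ∀ (r : ℝ) (p : Vertex → Prop), r ^ {z ∈ D.vertices | p z}.ncard =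
      ∏ z ∈ D.finite_vertices.toFinset, if p z then r else 1 := by
    intro r p
    rw [← Finset.prod_filter, Finset.prod_const]
    congr 1
    rw [Set.ncard_eq_toFinset_card _ (D.finite_vertices.subset fun z hz => hz.1)]
    congr 1
    ext z
    simp
  rw [weight, hpow, hpow, hpow, ← Finset.prod_mul_distrib, ← Finset.prod_mul_distrib]
  refine Finset.prod_congr rfl fun z _ => ?_
  unfold localWeight IsTypeA IsTypeB IsTypeC
  by_cases h1 : σ (sw z) = σ (ne z) <;> by_cases h2 : σ (nw z) = σ (se z) <;> simp [h1, h2]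

open scoped Classical in
/-- The largest weight that a vertex can have, given its even spins. -/
noncomputable def evenWeight (a b c : ℝ) (η : EvenFace → ℤˣ) (z : Vertex) : ℝ :=
  if z ∈ evenAgree η then c else if Even (z.1 + z.2) then b else a

/-- The relative weight of a disagreement of the odd spins at a vertex. -/
noncomputable def oddWeight (a b c : ℝ) (z : Vertex) : ℝ :=
  (if Even (z.1 + z.2) then a else b) / c

/-- The hypothesis is the ice rule at `z`; it excludes the case of two disagreeing pairs, which has
no type. -/
lemma localWeight_glue {a b c : ℝ} (hc : c ≠ 0) {D : Domain} {η : EvenFace → ℤˣ} {ξ : oddGroup D}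
    {z : Vertex} (hz : oddEdge D z ξ ≠ 1 → z ∈ evenAgree η) :
    localWeight a b c (evenExt η * ξ.1) z = evenWeight a b c η z *
      if oddEdge D z ξ = 1 then 1 else (evenAgree η).indicator (oddWeight a b c) z := by
  have e1 := glue_even₁ η ξ z
  have e2 := glue_even₂ η ξ z
  have o1 := glue_of_odd η ξ (odd_odd₁ z)
  have o2 := glue_of_odd η ξ (odd_odd₂ z)
  have hagree : z ∈ evenAgree η ↔
      (evenExt η * ξ.1) (even₁ z) = (evenExt η * ξ.1) (even₂ z) := by rw [e1, e2]; rfl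
  have hodd : oddEdge D z ξ = 1 ↔
      (evenExt η * ξ.1) (odd₁ z) = (evenExt η * ξ.1) (odd₂ z) := by
    rw [o1, o2, oddEdge_eq_one_iff]
  classical
  rw [Set.indicator_apply]
  unfold localWeight evenWeight oddWeight IsTypeA IsTypeB IsTypeC
  simp only [hodd, hagree, Ne] at hz ⊢
  generalize evenExt η * ξ.1 = σ at *
  unfold odd₁ odd₂ even₁ even₂ at *
  by_cases he : Even (z.1 + z.2)
  · simp only [he, if_true, eq_comm (a := σ (se z))] at hz ⊢
    by_cases h1 : σ (sw z) = σ (ne z) <;> by_cases h2 : σ (nw z) = σ (se z) <;>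
      simp_all [mul_div_cancel₀]
  · simp only [he, if_false, eq_comm (a := σ (se z))] at hz ⊢
    by_cases h1 : σ (sw z) = σ (ne z) <;> by_cases h2 : σ (nw z) = σ (se z) <;>
      simp_all [mul_div_cancel₀]

/-- The even spin configuration coincides with `τ` outside of the domain. -/
def Compatible (D : Domain) (τ : SpinConfig) (η : EvenFace → ℤˣ) : Prop :=
  ∀ u : EvenFace, u.1 ∉ D.faces → η u = τ u.1

lemma evenMarginal_of_not_compatible {D : Domain} {a b c : ℝ} {τ : SpinConfig}
    {η : EvenFace → ℤˣ} (h : ¬ Compatible D τ η) : evenMarginal D a b c τ η = 0 := by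
  unfold evenMarginal spinExpect
  refine Finset.sum_eq_zero fun σ hσ => ?_
  rw [Set.Finite.mem_toFinset] at hσ
  simp only
  rw [if_neg, mul_zero]
  rintro rfl
  exact h fun u hu => hσ.2 u.1 hu

/-- The even marginal as a product of local weights and the partition functions of two Ising
models. -/
theorem evenMarginal_of_compatible {D : Domain} {a b c : ℝ} (hc : c ≠ 0) {τ : SpinConfig}
    (hodd : ∀ u : Face, Odd (u.1 + u.2) → u ∉ D.faces → τ u = 1) {η : EvenFace → ℤˣ}
    (h : Compatible D τ η) :
    evenMarginal D a b c τ η = (partitionFunction D a b c τ)⁻¹ *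
      ((∏ z ∈ D.finite_vertices.toFinset, evenWeight a b c η z) *
      (isingZ D.finite_vertices.toFinset (oddEdge D) ((evenEq η 1).indicator (oddWeight a b c)) *
        isingZ D.finite_vertices.toFinset (oddEdge D)
          ((evenEq η (-1)).indicator (oddWeight a b c)))) := by
  classical
  rw [← isingZ_evenAgree, isingZ, Finset.mul_sum, Finset.mul_sum]
  unfold evenMarginal spinExpect
  simp only [mul_ite, mul_one, mul_zero]
  rw [← Finset.sum_filter]
  -- Configurations violating the ice rule have Ising weight zero and may be dropped.
  have hsub : ∑ ξ : oddGroup D with IceRule (evenExt η * ξ.1),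
      (partitionFunction D a b c τ)⁻¹ *
        ((∏ z ∈ D.finite_vertices.toFinset, evenWeight a b c η z) *
        isingWeight D.finite_vertices.toFinset (oddEdge D)
          ((evenAgree η).indicator (oddWeight a b c)) ξ) = _ :=
    Finset.sum_filter_of_ne fun ξ _ hne => by
      by_contra hcon
      rw [iceRule_glue] at hcon
      exact hne (by rw [isingWeight_indicator_eq_zero hcon, mul_zero, mul_zero])
  rw [← hsub]
  symm
  refine Finset.sum_bij (fun ξ _ => evenExt η * ξ.1) ?_ ?_ ?_ ?_
  · intro ξ hξ
    simp only [Finset.mem_filter, Finset.mem_univ, true_and, Set.Finite.mem_toFinset] at hξ ⊢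
    refine ⟨⟨hξ, fun u hu => ?_⟩, evenPart_glue η ξ⟩
    by_cases he : Even (u.1 + u.2)
    · rw [glue_of_even η ξ he, h ⟨u, he⟩ hu]
    · rw [Int.not_even_iff_odd] at he
      rw [glue_of_odd η ξ he, hodd u he hu, ξ.2 u fun h => hu h.2]
  · intro ξ _ ξ' _ he
    ext1
    exact mul_left_cancel he
  · intro σ hσ
    simp only [Finset.mem_filter, Set.Finite.mem_toFinset] at hσ
    obtain ⟨⟨hice, hout⟩, hη⟩ := hσ
    have hglue : evenExt η * (fun u => if Even (u.1 + u.2) then 1 else σ u) = σ := by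
      funext u
      by_cases he : Even (u.1 + u.2)
      · simp only [Pi.mul_apply, evenExt, he, dif_pos, if_true, mul_one]
        exact (congrFun hη ⟨u, he⟩).symm
      · simp [evenExt, he]
    refine ⟨⟨fun u => if Even (u.1 + u.2) then 1 else σ u, fun u hu => ?_⟩, ?_, hglue⟩
    · by_cases he : Even (u.1 + u.2)
      · simp [he]
      · rw [Int.not_even_iff_odd] at he
        have huD : u ∉ D.faces := fun h => hu ⟨he, h⟩
        simp [Int.not_even_iff_odd.2 he, hout u huD, hodd u he huD]
    · simp only [Finset.mem_filter, Finset.mem_univ, true_and]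
      rw [hglue]
      exact hice
  · intro ξ hξ
    simp only [Finset.mem_filter, Finset.mem_univ, true_and] at hξ
    rw [weight_eq_prod, div_eq_inv_mul, isingWeight, ← Finset.prod_mul_distrib]
    congr 1
    refine Finset.prod_congr rfl fun z _ => ?_
    rw [localWeight_glue hc ((iceRule_glue η ξ).1 hξ z)]

/-! ### The lattice condition. -/

/-- Both sides are equal unless the two configurations disagree at `z` in opposite ways; then join
and meet both agree there, and `a, b ≤ c` is used. -/
lemma evenWeight_mul_le {a b c : ℝ} (ha : 0 < a) (hb : 0 < b) (hac : a ≤ c) (hbc : b ≤ c)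
    (η η' : EvenFace → ℤˣ) (z : Vertex) :
    evenWeight a b c η z * evenWeight a b c η' z ≤
      evenWeight a b c (η ⊔ η') z * evenWeight a b c (η ⊓ η') z := by
  classical
  unfold evenWeight evenAgree
  simp only [Set.mem_ofPred_eq, evenExt_even₁, evenExt_even₂]
  set r := if Even (z.1 + z.2) then b else a
  have hr : 0 < r ∧ r ≤ c := by
    unfold r; split_ifs <;> constructor <;> assumption
  have key : ∀ x y x' y' : ℤˣ, (if x = y then c else r) * (if x' = y' then c else r) ≤
      (if x ⊔ x' = y ⊔ y' then c else r) * (if x ⊓ x' = y ⊓ y' then c else r) := by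
    have hle : (-1 : ℤˣ) ≤ 1 := by decide
    have hne : (1 : ℤˣ) ≠ -1 := by decide
    intro x y x' y'
    rcases Int.units_eq_one_or x with h1 | h1 <;> rcases Int.units_eq_one_or y with h2 | h2 <;>
    rcases Int.units_eq_one_or x' with h3 | h3 <;> rcases Int.units_eq_one_or y' with h4 | h4 <;>
    simp only [h1, h2, h3, h4, sup_of_le_left, sup_of_le_right, inf_of_le_left, inf_of_le_right,
      hle, le_refl, hne, hne.symm, if_true, if_false] <;> nlinarith
  exact key _ _ _ _

lemma oddWeight_mem_Icc {a b c : ℝ} (ha : 0 < a) (hb : 0 < b) (hac : a ≤ c) (hbc : b ≤ c)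
    (z : Vertex) : oddWeight a b c z ∈ Set.Icc 0 1 := by
  have hc := ha.trans_le hac
  unfold oddWeight
  split_ifs
  · exact ⟨by positivity, (div_le_one hc).2 hac⟩
  · exact ⟨by positivity, (div_le_one hc).2 hbc⟩

lemma evenMarginal_nonneg {D : Domain} {a b c : ℝ} (ha : 0 < a) (hb : 0 < b) (hc : 0 < c)
    {τ : SpinConfig} (hτ : IceRule τ) (η : EvenFace → ℤˣ) : 0 ≤ evenMarginal D a b c τ η := by
  have hZ := partitionFunction_pos D ha hb hc hτ
  refine Finset.sum_nonneg fun σ _ => mul_nonneg (div_nonneg ?_ hZ.le) ?_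
  · unfold weight; positivity
  · simp only
    split_ifs <;> simp

/-- The even marginal satisfies the FKG lattice condition. -/
theorem fkgLatticeCondition_evenMarginal {D : Domain} {a b c : ℝ} (ha : 0 < a) (hb : 0 < b)
    (hac : a ≤ c) (hbc : b ≤ c) {τ : SpinConfig} (hτ : IceRule τ)
    (hodd : ∀ u : Face, Odd (u.1 + u.2) → u ∉ D.faces → τ u = 1) :
    FKGLatticeCondition (evenMarginal D a b c τ) := by
  have hc := ha.trans_le hac
  intro η η'
  have hnn := evenMarginal_nonneg (D := D) ha hb hc hτ
  -- The marginal vanishes off the compatible configurations, which form a sublattice.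
  by_cases h : Compatible D τ η
  swap
  · rw [evenMarginal_of_not_compatible h, zero_mul]
    exact mul_nonneg (hnn _) (hnn _)
  by_cases h' : Compatible D τ η'
  swap
  · rw [evenMarginal_of_not_compatible h', mul_zero]
    exact mul_nonneg (hnn _) (hnn _)
  have hsup : Compatible D τ (η ⊔ η') := fun u hu => by
    rw [Pi.sup_apply, h u hu, h' u hu, sup_idem]
  have hinf : Compatible D τ (η ⊓ η') := fun u hu => by
    rw [Pi.inf_apply, h u hu, h' u hu, inf_idem]
  rw [evenMarginal_of_compatible hc.ne' hodd h, evenMarginal_of_compatible hc.ne' hodd h',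
    evenMarginal_of_compatible hc.ne' hodd hsup, evenMarginal_of_compatible hc.ne' hodd hinf]
  have hw : ∀ (η : EvenFace → ℤˣ) z, 0 ≤ evenWeight a b c η z := fun η z => by
    unfold evenWeight; split_ifs <;> positivity
  have hprod : (∏ z ∈ D.finite_vertices.toFinset, evenWeight a b c η z) *
      (∏ z ∈ D.finite_vertices.toFinset, evenWeight a b c η' z) ≤
      (∏ z ∈ D.finite_vertices.toFinset, evenWeight a b c (η ⊔ η') z) *
      (∏ z ∈ D.finite_vertices.toFinset, evenWeight a b c (η ⊓ η') z) := by
    rw [← Finset.prod_mul_distrib, ← Finset.prod_mul_distrib]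
    exact Finset.prod_le_prod (fun z _ => mul_nonneg (hw _ _) (hw _ _))
      fun z _ => evenWeight_mul_le ha hb hac hbc η η' z
  have hpos : ∀ x y : ℤˣ, (x = 1 ∨ y = 1 → x ⊔ y = 1) ∧ (x = 1 ∧ y = 1 → x ⊓ y = 1) ∧
      (x = -1 ∨ y = -1 → x ⊓ y = -1) ∧ (x = -1 ∧ y = -1 → x ⊔ y = -1) := by decide
  have ht := oddWeight_mem_Icc ha hb hac hbc
  have hplus := isingZ_indicator_mul_le D.finite_vertices.toFinset (oddEdge D) ht
    (evenEq η 1) (evenEq η' 1) (evenEq (η ⊔ η') 1) (evenEq (η ⊓ η') 1)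
    (by
      rintro z (hz | hz) <;>
        simp only [evenEq, Set.mem_ofPred_eq, evenExt_even₁, evenExt_even₂] at hz ⊢
      · exact ⟨(hpos _ _).1 (Or.inl hz.1), (hpos _ _).1 (Or.inl hz.2)⟩
      · exact ⟨(hpos _ _).1 (Or.inr hz.1), (hpos _ _).1 (Or.inr hz.2)⟩)
    (by
      rintro z ⟨hz, hz'⟩
      simp only [evenEq, Set.mem_ofPred_eq, evenExt_even₁, evenExt_even₂] at hz hz' ⊢
      exact ⟨(hpos _ _).2.1 ⟨hz.1, hz'.1⟩, (hpos _ _).2.1 ⟨hz.2, hz'.2⟩⟩)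
  -- Negative edges decrease with the configuration, so join and meet exchange roles.
  have hminus := isingZ_indicator_mul_le D.finite_vertices.toFinset (oddEdge D) ht
    (evenEq η (-1)) (evenEq η' (-1)) (evenEq (η ⊓ η') (-1)) (evenEq (η ⊔ η') (-1))
    (by
      rintro z (hz | hz) <;>
        simp only [evenEq, Set.mem_ofPred_eq, evenExt_even₁, evenExt_even₂] at hz ⊢
      · exact ⟨(hpos _ _).2.2.1 (Or.inl hz.1), (hpos _ _).2.2.1 (Or.inl hz.2)⟩
      · exact ⟨(hpos _ _).2.2.1 (Or.inr hz.1), (hpos _ _).2.2.1 (Or.inr hz.2)⟩)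
    (by
      rintro z ⟨hz, hz'⟩
      simp only [evenEq, Set.mem_ofPred_eq, evenExt_even₁, evenExt_even₂] at hz hz' ⊢
      exact ⟨(hpos _ _).2.2.2 ⟨hz.1, hz'.1⟩, (hpos _ _).2.2.2 ⟨hz.2, hz'.2⟩⟩)
  have hind : ∀ A : Set Vertex, 0 ≤ isingZ D.finite_vertices.toFinset (oddEdge D)
      (A.indicator (oddWeight a b c)) := fun A =>
    isingZ_nonneg _ _ fun z => Set.indicator_nonneg (fun z _ => (ht z).1) z
  have hprodnn : ∀ η : EvenFace → ℤˣ,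
      0 ≤ ∏ z ∈ D.finite_vertices.toFinset, evenWeight a b c η z := fun η =>
    Finset.prod_nonneg fun z _ => hw η z
  have hmul := mul_le_mul hprod (mul_le_mul hplus hminus
    (mul_nonneg (hind _) (hind _)) (mul_nonneg (hind _) (hind _)))
    (mul_nonneg (mul_nonneg (hind _) (hind _)) (mul_nonneg (hind _) (hind _)))
    (mul_nonneg (hprodnn _) (hprodnn _))
  have hZ := sq_nonneg (partitionFunction D a b c τ)⁻¹
  refine le_of_eq_of_le ?_ ((mul_le_mul_of_nonneg_left hmul hZ).trans_eq ?_) <;> ring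

/-! ### Reduction to a finite lattice and the inequality for increasing functions. -/

open scoped Classical in
/-- The even spin configuration with the given values in the domain and those of `τ` outside. -/
noncomputable def extendEven (D : Domain) (τ : SpinConfig)
    (θ : {u : EvenFace // u.1 ∈ D.faces} → ℤˣ) : EvenFace → ℤˣ := fun u =>
  if h : u.1 ∈ D.faces then θ ⟨u, h⟩ else τ u.1

instance (D : Domain) : Finite {u : EvenFace // u.1 ∈ D.faces} := by
  have : Finite D.faces := D.finite_faces
  refine Finite.of_injective (β := D.faces) (fun u => ⟨u.1.1, u.2⟩) fun u v h => ?_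
  exact Subtype.ext (Subtype.ext (by simpa using h))

section ExtendEven

variable (D : Domain) (τ : SpinConfig)

lemma extendEven_mono : Monotone (extendEven D τ) := fun θ θ' h u => by
  unfold extendEven
  split_ifs with hu
  · exact h _
  · exact le_rfl

lemma extendEven_sup (θ θ' : {u : EvenFace // u.1 ∈ D.faces} → ℤˣ) :
    extendEven D τ (θ ⊔ θ') = extendEven D τ θ ⊔ extendEven D τ θ' := by
  funext u
  by_cases hu : u.1 ∈ D.faces <;> simp [extendEven, hu]

lemma extendEven_inf (θ θ' : {u : EvenFace // u.1 ∈ D.faces} → ℤˣ) :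
    extendEven D τ (θ ⊓ θ') = extendEven D τ θ ⊓ extendEven D τ θ' := by
  funext u
  by_cases hu : u.1 ∈ D.faces <;> simp [extendEven, hu]

lemma evenPart_eq_extendEven_iff {σ : SpinConfig} (hσ : ∀ u, u ∉ D.faces → σ u = τ u)
    (θ : {u : EvenFace // u.1 ∈ D.faces} → ℤˣ) :
    evenPart σ = extendEven D τ θ ↔ (fun u => σ u.1.1) = θ := by
  constructor
  · intro h
    funext u
    have := congrFun h u.1
    simpa [evenPart, extendEven, u.2] using this
  · rintro rfl
    funext u
    by_cases hu : u.1 ∈ D.faces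
    · simp [evenPart, extendEven, hu]
    · simp [evenPart, extendEven, hu, hσ u.1 hu]

lemma spinExpect_evenPart [Fintype ({u : EvenFace // u.1 ∈ D.faces} → ℤˣ)] (a b c : ℝ)
    (F : (EvenFace → ℤˣ) → ℝ) :
    spinExpect D a b c τ (fun σ => F (evenPart σ)) =
      ∑ θ, evenMarginal D a b c τ (extendEven D τ θ) * F (extendEven D τ θ) := by
  classical
  unfold evenMarginal spinExpect
  simp only [Finset.sum_mul]
  rw [Finset.sum_comm]
  refine Finset.sum_congr rfl fun σ hσ => ?_
  rw [Set.Finite.mem_toFinset] at hσ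
  have hiff := evenPart_eq_extendEven_iff D τ hσ.2
  rw [Finset.sum_eq_single (fun u => σ u.1.1)]
  · have h := (hiff _).2 rfl
    rw [if_pos h, ← h, mul_one]
  · intro θ _ hθ
    rw [if_neg fun h => hθ ((hiff θ).1 h).symm, mul_zero, zero_mul]
  · exact fun h => absurd (Finset.mem_univ _) h

end ExtendEven

lemma spinExpect_one (D : Domain) {a b c : ℝ} (ha : 0 < a) (hb : 0 < b) (hc : 0 < c)
    {τ : SpinConfig} (hτ : IceRule τ) : spinExpect D a b c τ (fun _ => 1) = 1 := by
  unfold spinExpect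
  simp only [mul_one]
  rw [← Finset.sum_div]
  exact div_self (partitionFunction_pos D ha hb hc hτ).ne'

end SixVertex

/-- The FKG inequality for a probability mass function and functions of arbitrary sign. -/
lemma fkg_of_sum_eq_one {L : Type*} [DistribLattice L] [Fintype L] {μ f g : L → ℝ} (m : L)
    (hm : ∀ x, m ≤ x) (hμ₀ : 0 ≤ μ) (hμ₁ : ∑ x, μ x = 1) (hμ : FKGLatticeCondition μ)
    (hf : Monotone f) (hg : Monotone g) :
    (∑ x, μ x * f x) * (∑ x, μ x * g x) ≤ ∑ x, μ x * (f x * g x) := by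
  classical
  -- `fkg` is applied to nonnegative functions, obtained by subtracting the values at the least
  -- element `m`; covariances do not change.
  have h := fkg (f := fun x => f x - f m) (g := fun x => g x - g m) (μ := μ) hμ₀
    (fun x => sub_nonneg.2 (hf (hm x))) (fun x => sub_nonneg.2 (hg (hm x)))
    (fun x y hxy => sub_le_sub_right (hf hxy) _) (fun x y hxy => sub_le_sub_right (hg hxy) _)
    (fun x y => by rw [mul_comm (μ (x ⊓ y))]; exact hμ x y)
  have ef : ∑ x, μ x * (f x - f m) = ∑ x, μ x * f x - f m := by
    simp only [mul_sub, Finset.sum_sub_distrib, ← Finset.sum_mul, hμ₁, one_mul]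
  have eg : ∑ x, μ x * (g x - g m) = ∑ x, μ x * g x - g m := by
    simp only [mul_sub, Finset.sum_sub_distrib, ← Finset.sum_mul, hμ₁, one_mul]
  have efg : ∑ x, μ x * ((f x - f m) * (g x - g m)) =
      ∑ x, μ x * (f x * g x) - f m * ∑ x, μ x * g x - g m * ∑ x, μ x * f x + f m * g m := by
    have : ∀ x, μ x * ((f x - f m) * (g x - g m)) =
        μ x * (f x * g x) - f m * (μ x * g x) - g m * (μ x * f x) + μ x * (f m * g m) :=
      fun x => by ring
    simp only [this, Finset.sum_add_distrib, Finset.sum_sub_distrib, ← Finset.mul_sum,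
      ← Finset.sum_mul, hμ₁, one_mul]
  rw [ef, eg, efg, hμ₁, one_mul] at h
  linarith

theorem theorem2p4 (D : SixVertex.Domain) (τ : SixVertex.SpinConfig) (hτ : SixVertex.IceRule τ)
    (hodd : ∀ u : SixVertex.Face, Odd (u.1 + u.2) → u ∉ D.faces → τ u = 1)
    (a b c : ℝ) (ha : 0 < a) (hb : 0 < b) (hc : 0 < c) (hac : a ≤ c) (hbc : b ≤ c) :
    FKGLatticeCondition (SixVertex.evenMarginal D a b c τ) ∧
      ∀ f g : (SixVertex.EvenFace → ℤˣ) → ℝ, Monotone f → Monotone g →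
        SixVertex.spinExpect D a b c τ (fun σ => f (SixVertex.evenPart σ)) *
            SixVertex.spinExpect D a b c τ (fun σ => g (SixVertex.evenPart σ)) ≤
          SixVertex.spinExpect D a b c τ
            (fun σ => f (SixVertex.evenPart σ) * g (SixVertex.evenPart σ)) := by
  have hfkg := SixVertex.fkgLatticeCondition_evenMarginal (D := D) ha hb hac hbc hτ hodd
  refine ⟨hfkg, fun f g hf hg => ?_⟩
  have := Fintype.ofFinite ({u : SixVertex.EvenFace // u.1 ∈ D.faces} → ℤˣ)
  have hmono := SixVertex.extendEven_mono D τ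
  have hneg : ∀ x : ℤˣ, -1 ≤ x := by decide
  have hone := SixVertex.spinExpect_evenPart D τ a b c fun _ => 1
  rw [SixVertex.spinExpect_one D ha hb hc hτ] at hone
  simp only [mul_one] at hone
  rw [SixVertex.spinExpect_evenPart D τ a b c f, SixVertex.spinExpect_evenPart D τ a b c g,
    SixVertex.spinExpect_evenPart D τ a b c fun η => f η * g η]
  refine fkg_of_sum_eq_one (fun _ => -1) (fun θ u => hneg (θ u))
    (fun θ => SixVertex.evenMarginal_nonneg ha hb hc hτ _) hone.symm (fun θ θ' => ?_)
    (hf.comp hmono) (hg.comp hmono)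
  rw [SixVertex.extendEven_sup, SixVertex.extendEven_inf]
  exact hfkg _ _
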